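/- All graphs are finite, simple and undirected. For a graph $H$, let $\mathrm{rep}(H)$ be the maximum number of vertices of $H$ that have the same degree in $H$, and let $\mathrm{maxrep}(H)$ be the number of vertices of $H$ whose degree is the maximum degree of $H$. For integers $k \ge 1$ and $d \ge 0$, let $g(k,d)$ be the least integer such that every graph with maximum degree at most $d$ and more than $g(k,d)$ vertices has an induced subgraph $H$ with $\mathrm{rep}(H) \ge k$, and let $h(k,d)$ be the least integer such that every graph with maximum degree at most $d$ and more than $h(k,d)$ vertices has an induced subgraph $H$ with $\mathrm{maxrep}(H) \ge k$. Theorem. There is an absolute constant $c > 0$ such that for every integer $d \ge 2$ the limits $\lim_{k\to\infty} g(k,d)/k$ and $\lim_{k\to\infty} h(k,d)/k$ exist and $$c\left(\frac{d}{\log d}\right)^{1/3} \le \lim_{k\to\infty}\frac{g(k,d)}{k} \le \lim_{k\to\infty}\frac{h(k,d)}{k} \le \frac d2+1.$$ -/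

import Mathlib

open Filter Topology

namespace InducedRep

/-- The repetition number of a finite graph: the maximum multiplicity of a value
in its degree sequence (`0` for the graph without vertices). -/
noncomputable def rep {V : Type*} [Fintype V] (G : SimpleGraph V) : ℕ :=
  open Classical in
  Finset.univ.sup fun u : V => (Finset.univ.filter fun v : V => G.degree v = G.degree u).card

/-- The number of vertices of maximum degree in a finite graph. -/
noncomputable def maxrep {V : Type*} [Fintype V] (G : SimpleGraph V) : ℕ :=
  open Classical in
  (Finset.univ.filter fun v : V => G.degree v = G.maxDegree).card

/-- `m` is such that every finite graph with maximum degree at most `d` and more than `m` vertices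
has an induced subgraph `H` with `rep H ≥ k`. -/
def ForcesRep (k d m : ℕ) : Prop :=
  open Classical in
  ∀ (V : Type) [Fintype V] (G : SimpleGraph V), G.maxDegree ≤ d → m < Fintype.card V →
    ∃ s : Finset V, k ≤ rep (G.induce (s : Set V))

/-- `m` is such that every finite graph with maximum degree at most `d` and more than `m` vertices
has an induced subgraph `H` with `maxrep H ≥ k`. -/
def ForcesMaxrep (k d m : ℕ) : Prop :=
  open Classical in
  ∀ (V : Type) [Fintype V] (G : SimpleGraph V), G.maxDegree ≤ d → m < Fintype.card V →
    ∃ s : Finset V, k ≤ maxrep (G.induce (s : Set V))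

/-- `g k d` is the least `m` such that every graph with maximum degree at most `d` and more than
`m` vertices has an induced subgraph with repetition number at least `k`
(it exists, see `isLeast_g`). -/
noncomputable def g (k d : ℕ) : ℕ := sInf {m | ForcesRep k d m}

/-- `h k d` is the least `m` such that every graph with maximum degree at most `d` and more than
`m` vertices has an induced subgraph with at least `k` vertices of maximum degree
(it exists, see `isLeast_h`). -/
noncomputable def h (k d : ℕ) : ℕ := sInf {m | ForcesMaxrep k d m}

/-- The number of maximum degree vertices is at most the repetition number. -/
theorem maxrep_le_rep {V : Type*} [Fintype V] (G : SimpleGraph V) : maxrep G ≤ rep G := by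
  classical
  unfold maxrep rep
  rcases isEmpty_or_nonempty V with hV | hV
  · simp
  · obtain ⟨u, hu⟩ := G.exists_maximal_degree_vertex
    refine le_trans (le_of_eq ?_) (Finset.le_sup (Finset.mem_univ u))
    rw [← hu]

theorem forcesMaxrep_mul (k d : ℕ) : ForcesMaxrep k d (k * (d + 1)) := by
  classical
  intro V _ G hd hV
  -- a maximal independent set
  obtain ⟨s, hs⟩ := (Set.toFinite {s : Finset V | G.IsIndepSet (s : Set V)}).exists_maximal
    ⟨∅, by simp [SimpleGraph.IsIndepSet]⟩
  have hind : G.IsIndepSet (s : Set V) := hs.prop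
  refine ⟨s, ?_⟩
  have hcov : (Finset.univ : Finset V) ⊆ s.biUnion fun v => insert v (G.neighborFinset v) := by
    intro w _
    by_contra hw
    simp only [Finset.mem_biUnion, Finset.mem_insert, SimpleGraph.mem_neighborFinset,
      not_exists, not_and, not_or] at hw
    have hws : w ∉ s := fun hmem => (hw w hmem).1 rfl
    have hins : G.IsIndepSet ((insert w s : Finset V) : Set V) := by
      intro a ha b hb hab
      simp only [Finset.coe_insert, Set.mem_insert_iff, Finset.mem_coe] at ha hb
      rcases ha with rfl | ha <;> rcases hb with rfl | hb
      · exact absurd rfl hab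
      · exact fun hadj => (hw b hb).2 hadj.symm
      · exact (hw a ha).2
      · exact hind ha hb hab
    exact hws (hs.le_of_ge hins (Finset.subset_insert w s) (Finset.mem_insert_self w s))
  have hcard : Fintype.card V ≤ s.card * (d + 1) := by
    calc Fintype.card V ≤ _ := Finset.card_le_card hcov
      _ ≤ s.card * (d + 1) := Finset.card_biUnion_le_card_mul _ _ _ fun v _ =>
          (Finset.card_insert_le _ _).trans (by
            have := (G.degree_le_maxDegree v).trans hd
            simpa using this)
  have hk : k ≤ s.card := (Nat.lt_of_mul_lt_mul_right (hV.trans_le hcard)).le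
  have hbot : G.induce (s : Set V) = ⊥ := by
    ext a b
    simp only [SimpleGraph.comap_adj, Function.Embedding.subtype_apply, SimpleGraph.bot_adj,
      iff_false]
    intro hadj
    exact hind a.2 b.2 hadj.ne hadj
  have hz : ∀ v, (G.induce (s : Set V)).degree v = 0 := by
    intro v
    rw [SimpleGraph.degree_eq_zero]
    intro w
    simp [hbot]
  have hm : (G.induce (s : Set V)).maxDegree = 0 :=
    Nat.le_zero.mp (SimpleGraph.maxDegree_le_of_forall_degree_le _ _ fun v => (hz v).le)
  unfold maxrep
  refine hk.trans (le_of_eq ?_)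
  rw [Finset.filter_true_of_mem (fun v _ => by convert (hz v).trans hm.symm), Finset.card_univ]
  simp

/-- The defining property of `h`. -/
theorem isLeast_h (k d : ℕ) : IsLeast {m | ForcesMaxrep k d m} (h k d) :=
  ⟨Nat.sInf_mem ⟨_, forcesMaxrep_mul k d⟩, fun _ hm => Nat.sInf_le hm⟩

/-- The defining property of `g`. -/
theorem isLeast_g (k d : ℕ) : IsLeast {m | ForcesRep k d m} (g k d) := by
  refine ⟨Nat.sInf_mem ⟨k * (d + 1), ?_⟩, fun _ hm => Nat.sInf_le hm⟩
  intro V _ G hd hV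
  obtain ⟨s, hs⟩ := forcesMaxrep_mul k d V G hd hV
  exact ⟨s, hs.trans (maxrep_le_rep _)⟩

end InducedRep

namespace InducedRep

/-! Upper bound (`exists_many_max_degree`): induct on `d`. If no induced subgraph has `k` vertices
of maximum degree, then by induction every set of at least `(i + 2) k / 2` vertices with `i < d`
contains a vertex of degree more than `i`. Deleting a vertex of maximum degree repeatedly and
summing the degrees lost forces so many edges that at least `k` vertices must have degree exactly
`d`.

Limits: a disjoint union of counterexamples is a counterexample, so `g` and `h` are superadditive in
`k`, and Fekete's lemma applies. The limit is also the supremum of the quotients, so a single graph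
bounds it from below.

Lower bound: on `n = d + 1` vertices, join `a` and `b` independently with probability `(a + b) /
(2n)`. The maximum degree is at most `d` automatically. In every vertex set `S`, expected degrees
increase with the label, up to a diagonal correction. Among `3t` vertices of equal degree, some `t`
have labels exceeding those of another `t` by at least `t`; yet the expected degree sums of these
two groups differ by at least about `|S| t² / (2n)`. An exponential moment bound gives each such
coincidence probability at most `exp(-t³ / (256 n²)) ^ |S|`. This beats the `4 ^ |S|` pairs of
subsets of `S` and the choice of `S` once `t³` is of order `n² log n`, so `g (3t) d > d` for such a
`t`. -/

/-- The number of neighbours of `v` inside `s`. -/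
noncomputable def degIn {V : Type*} (G : SimpleGraph V) (s : Finset V) (v : V) : ℕ :=
  open Classical in (s.filter fun w => G.Adj v w).card

/-! ### Degrees in induced subgraphs -/

section

open Classical

variable {V : Type*} (G : SimpleGraph V)

theorem degree_induce (s : Finset V) (v : (s : Set V))
    [Fintype ((G.induce (s : Set V)).neighborSet v)] :
    (G.induce (s : Set V)).degree v = degIn G s v := by
  rw [← SimpleGraph.card_neighborFinset_eq_degree, degIn]
  refine Finset.card_bij (fun w _ => (w : V)) ?_ ?_ ?_
  · intro a ha
    simpa using ha
  · intro a _ b _ h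
    exact Subtype.ext h
  · intro b hb
    simp only [Finset.mem_filter] at hb
    exact ⟨⟨b, hb.1⟩, by simpa using hb.2, rfl⟩

theorem card_filter_induce (s : Finset V) (j : ℕ) :
    (Finset.univ.filter fun v : (s : Set V) => degIn G s v = j).card =
      (s.filter fun v => degIn G s v = j).card := by
  refine Finset.card_bij (fun w _ => (w : V)) ?_ ?_ ?_
  · intro a ha
    simpa using ha
  · intro a _ b _ h
    exact Subtype.ext h
  · intro b hb
    simp only [Finset.mem_filter] at hb
    exact ⟨⟨b, hb.1⟩, by simpa using hb.2, rfl⟩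

theorem le_rep_induce_iff (s : Finset V) (k : ℕ) :
    k ≤ rep (G.induce (s : Set V)) ↔ ∃ j, k ≤ (s.filter fun v => degIn G s v = j).card := by
  unfold rep
  simp only [degree_induce, card_filter_induce]
  rcases Nat.eq_zero_or_pos k with rfl | hk
  · simp
  rw [Finset.le_sup_iff (by simpa using hk)]
  constructor
  · rintro ⟨u, -, hu⟩
    exact ⟨_, hu⟩
  · rintro ⟨j, hj⟩
    obtain ⟨u, hu⟩ := Finset.card_pos.mp (hk.trans_le hj)
    rw [Finset.mem_filter] at hu
    exact ⟨⟨u, hu.1⟩, Finset.mem_univ _, by simpa [hu.2] using hj⟩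

/-- Here `j` need only bound the degrees: for `k > 0` the second condition makes it attained. This
form passes to the two sides of a disjoint union with the same `j`. -/
theorem le_maxrep_induce_iff (s : Finset V) (k : ℕ) :
    k ≤ maxrep (G.induce (s : Set V)) ↔
      ∃ j, (∀ v ∈ s, degIn G s v ≤ j) ∧ k ≤ (s.filter fun v => degIn G s v = j).card := by
  unfold maxrep
  simp only [degree_induce, card_filter_induce]
  constructor
  · intro h
    refine ⟨_, fun v hv => ?_, h⟩
    have := (G.induce (s : Set V)).degree_le_maxDegree ⟨v, hv⟩
    rwa [degree_induce] at this
  · rintro ⟨j, hj, hk⟩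
    rcases Nat.eq_zero_or_pos k with rfl | hk0
    · simp
    obtain ⟨u, hu⟩ := Finset.card_pos.mp (hk0.trans_le hk)
    rw [Finset.mem_filter] at hu
    have hm : (G.induce (s : Set V)).maxDegree = j := by
      apply le_antisymm
      · refine SimpleGraph.maxDegree_le_of_forall_degree_le _ _ fun v => ?_
        rw [degree_induce]
        exact hj v v.2
      · have := (G.induce (s : Set V)).degree_le_maxDegree ⟨u, hu.1⟩
        rwa [degree_induce, hu.2] at this
    refine hk.trans (le_of_eq ?_)
    congr! 3
    convert hm.symm

theorem degIn_le_maxDegree [Fintype V] (s : Finset V) (v : V) : degIn G s v ≤ G.maxDegree := by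
  refine le_trans ?_ (G.degree_le_maxDegree v)
  rw [← SimpleGraph.card_neighborFinset_eq_degree, degIn]
  exact Finset.card_le_card fun w hw => by simpa using (Finset.mem_filter.mp hw).2

/-! ### Upper bound -/

theorem degIn_erase_add {s : Finset V} {x : V} (hx : x ∈ s) (v : V) :
    degIn G s v = degIn G (s.erase x) v + if G.Adj v x then 1 else 0 := by
  unfold degIn
  conv_lhs => rw [← Finset.insert_erase hx, Finset.filter_insert]
  split_ifs with h
  · rw [Finset.card_insert_of_notMem (by simp)]
  · simp

theorem sum_degIn_erase {s : Finset V} {x : V} (hx : x ∈ s) :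
    ∑ v ∈ s, degIn G s v = ∑ v ∈ s.erase x, degIn G (s.erase x) v + 2 * degIn G s x := by
  rw [← Finset.add_sum_erase s _ hx, Finset.sum_congr rfl fun v _ => degIn_erase_add G hx v,
    Finset.sum_add_distrib, Finset.sum_boole]
  have : ((s.erase x).filter fun v => G.Adj v x).card = degIn G s x := by
    unfold degIn
    congr 1
    ext w
    simp only [Finset.mem_filter, Finset.mem_erase]
    constructor
    · rintro ⟨⟨_, h⟩, h2⟩
      exact ⟨h, h2.symm⟩
    · rintro ⟨h, h2⟩
      exact ⟨⟨h2.ne', h⟩, h2.symm⟩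
  simp only [this, Nat.cast_id]
  ring

/-- If every induced subgraph on `n` vertices with `(i + 2) k ≤ 2 n` has a vertex of degree more
than `i`, for all `i < d`, then there are many edges. -/
theorem sum_le_sum_degIn (k d : ℕ)
    (H : ∀ i < d, ∀ s : Finset V, (i + 2) * k ≤ 2 * s.card → s.Nonempty →
      ∃ v ∈ s, i < degIn G s v) (s : Finset V) :
    ∑ i ∈ Finset.range d, (2 * s.card + 1 - (i + 2) * k) ≤ ∑ v ∈ s, degIn G s v + d := by
  induction hn : s.card generalizing s with
  | zero =>
    -- A summand can be `1` here only when `k = 0`; the `+ d` on the right covers this.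
    calc ∑ i ∈ Finset.range d, (2 * 0 + 1 - (i + 2) * k) ≤ ∑ i ∈ Finset.range d, 1 :=
          Finset.sum_le_sum fun i _ => by omega
      _ ≤ _ := by simp
  | succ n ih =>
    have hs : s.Nonempty := Finset.card_pos.mp (by omega)
    obtain ⟨x, hx, hmax⟩ := s.exists_max_image (degIn G s) hs
    have h1 := ih (s.erase x) (by rw [Finset.card_erase_of_mem hx, hn]; rfl)
    rw [sum_degIn_erase G hx]
    -- The truncated term grows by at most `2`, and it is still `0` as long as `2 (n + 1) < (i + 2)
    -- k`. Otherwise the deleted vertex has degree more than `i`, so at most `degIn G s x` of the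
    -- terms grow, and deletion removes `2 * degIn G s x` from the degree sum.
    have h2 : ∀ i ∈ Finset.range d, (2 * (n + 1) + 1 - (i + 2) * k) ≤
        (2 * n + 1 - (i + 2) * k) + if i < degIn G s x then 2 else 0 := by
      intro i hi
      split_ifs with h
      · omega
      · have : ¬ (i + 2) * k ≤ 2 * s.card := by
          intro hle
          obtain ⟨v, hv, hlt⟩ := H i (Finset.mem_range.mp hi) s hle hs
          exact h (hlt.trans_le (hmax v hv))
        omega
    have h3 : ∑ i ∈ Finset.range d, (if i < degIn G s x then 2 else 0) ≤ 2 * degIn G s x := by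
      rw [← Finset.sum_filter, Finset.sum_const, smul_eq_mul, mul_comm]
      refine Nat.mul_le_mul_left _ ?_
      calc _ ≤ (Finset.range (degIn G s x)).card :=
            Finset.card_le_card fun i hi => by simpa using (Finset.mem_filter.mp hi).2
        _ = _ := Finset.card_range _
    have h4 := Finset.sum_le_sum h2
    rw [Finset.sum_add_distrib] at h4
    omega

/-- The degree sum is at least `2 d |s| - d (d + 3) k / 2` by deletion, and at most `(d - 1) |s|`
plus the number of vertices of degree `d`. That number is therefore at least `(d + 1) |s| - d (d +
3) k / 2`, which is at least `k` when `2 |s| ≥ (d + 2) k`. -/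
theorem exists_many_max_degree (k d : ℕ) (s : Finset V) (hd : ∀ v ∈ s, degIn G s v ≤ d)
    (hs : (d + 2) * k ≤ 2 * s.card) :
    ∃ t : Finset V, ∃ j, (∀ v ∈ t, degIn G t v ≤ j) ∧
      k ≤ (t.filter fun v => degIn G t v = j).card := by
  induction d using Nat.strong_induction_on generalizing s with
  | _ d ih =>
    by_contra hno
    have hH : ∀ i < d, ∀ t : Finset V, (i + 2) * k ≤ 2 * t.card → t.Nonempty →
        ∃ v ∈ t, i < degIn G t v := by
      intro i hi t ht _
      by_contra! hc
      exact hno (ih i hi t hc ht)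
    have h1 := sum_le_sum_degIn G k d hH s
    have h2 : ∑ v ∈ s, degIn G s v + s.card ≤
        d * s.card + (s.filter fun v => degIn G s v = d).card := by
      rw [Finset.card_eq_sum_ones, ← Finset.sum_add_distrib, Finset.mul_sum, Finset.card_filter,
        ← Finset.sum_add_distrib]
      refine Finset.sum_le_sum fun v hv => ?_
      have := hd v hv
      split_ifs with h <;> omega
    apply hno
    refine ⟨s, d, hd, ?_⟩
    have h3 : ∑ i ∈ Finset.range d, (2 * s.card + 1) ≤
        ∑ i ∈ Finset.range d, (2 * s.card + 1 - (i + 2) * k) +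
          ∑ i ∈ Finset.range d, (i + 2) * k := by
      rw [← Finset.sum_add_distrib]
      exact Finset.sum_le_sum fun i _ => by omega
    have h4 : 2 * ∑ i ∈ Finset.range d, (i + 2) * k = d * (d + 3) * k := by
      clear * -
      induction d with
      | zero => simp
      | succ d ih =>
        rw [Finset.sum_range_succ, mul_add, ih]
        ring
    rw [Finset.sum_const, Finset.card_range, smul_eq_mul] at h3
    nlinarith

end

theorem forcesMaxrep_half (k d : ℕ) : ForcesMaxrep k d ((d + 2) * k / 2) := by
  classical
  intro V _ G hd hV
  obtain ⟨t, ht⟩ := exists_many_max_degree G k d Finset.univ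
    (fun v _ => (degIn_le_maxDegree G _ v).trans (by convert hd)) (by
      rw [Finset.card_univ]; omega)
  exact ⟨t, (le_maxrep_induce_iff G t k).mpr ht⟩

/-! ### Superadditivity and existence of the limits -/

section

open Classical

/-- Common form of `ForcesRep` (for `Q = False`) and `ForcesMaxrep` (for `Q = True`). -/
def Forces (Q : Prop) (k d m : ℕ) : Prop :=
  ∀ (V : Type) [Fintype V] (G : SimpleGraph V), (∀ v, degIn G Finset.univ v ≤ d) →
    m < Fintype.card V → ∃ (s : Finset V) (j : ℕ), (Q → ∀ v ∈ s, degIn G s v ≤ j) ∧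
      k ≤ (s.filter fun v => degIn G s v = j).card

theorem degIn_univ {V : Type*} [Fintype V] (G : SimpleGraph V) (v : V) :
    degIn G Finset.univ v = G.degree v := by
  rw [← SimpleGraph.card_neighborFinset_eq_degree, degIn, SimpleGraph.neighborFinset_eq_filter]

theorem maxDegree_le_iff {V : Type*} [Fintype V] (G : SimpleGraph V) (d : ℕ) :
    G.maxDegree ≤ d ↔ ∀ v, degIn G Finset.univ v ≤ d := by
  simp only [degIn_univ]
  exact ⟨fun h v => (G.degree_le_maxDegree v).trans h,
    fun h => G.maxDegree_le_of_forall_degree_le d h⟩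

theorem forcesRep_iff (k d m : ℕ) : ForcesRep k d m ↔ Forces False k d m := by
  unfold ForcesRep Forces
  simp only [le_rep_induce_iff, maxDegree_le_iff, false_imp_iff, true_and]

theorem forcesMaxrep_iff (k d m : ℕ) : ForcesMaxrep k d m ↔ Forces True k d m := by
  unfold ForcesMaxrep Forces
  simp only [le_maxrep_induce_iff, maxDegree_le_iff, true_imp_iff]

theorem Forces.mono {Q : Prop} {k l d m n : ℕ} (h : Forces Q k d m) (hl : l ≤ k) (hm : m ≤ n) :
    Forces Q l d n := by
  intro V _ G hG hc
  obtain ⟨s, j, hs, hj⟩ := h V G hG (hm.trans_lt hc)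
  exact ⟨s, j, hs, hl.trans hj⟩

section Sum

variable {V W : Type*} (G : SimpleGraph V) (H : SimpleGraph W)

theorem degIn_sum_inl (s : Finset (V ⊕ W)) (v : V) :
    degIn (G ⊕g H) s (Sum.inl v) = degIn G s.toLeft v := by
  unfold degIn
  symm
  refine Finset.card_bij (fun w _ => Sum.inl w) ?_ ?_ ?_
  · intro a ha
    simpa using ha
  · intro a _ b _ h
    simpa using h
  · rintro (b | b) hb
    · exact ⟨b, by simpa using hb, rfl⟩
    · simp at hb

theorem degIn_sum_inr (s : Finset (V ⊕ W)) (w : W) :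
    degIn (G ⊕g H) s (Sum.inr w) = degIn H s.toRight w := by
  unfold degIn
  symm
  refine Finset.card_bij (fun w _ => Sum.inr w) ?_ ?_ ?_
  · intro a ha
    simpa using ha
  · intro a _ b _ h
    simpa using h
  · rintro (b | b) hb
    · simp at hb
    · exact ⟨b, by simpa using hb, rfl⟩

theorem card_filter_degIn_sum (s : Finset (V ⊕ W)) (j : ℕ) :
    (s.filter fun v => degIn (G ⊕g H) s v = j).card =
      (s.toLeft.filter fun v => degIn G s.toLeft v = j).card +
        (s.toRight.filter fun v => degIn H s.toRight v = j).card := by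
  rw [← Finset.card_toLeft_add_card_toRight]
  congr 2
  · ext v
    simp [degIn_sum_inl]
  · ext v
    simp [degIn_sum_inr]

end Sum

/-- In the disjoint union of two counterexamples, each side has too few vertices of any given degree
`j`. The two sides have at least `m + 1` and `n + 1` vertices, which allows the extra `1`. -/
theorem not_forces_add {Q : Prop} {k l d m n : ℕ} (hm : ¬ Forces Q k d m)
    (hn : ¬ Forces Q l d n) : ¬ Forces Q (k + l) d (m + n + 1) := by
  intro h
  unfold Forces at hm hn
  push Not at hm hn
  obtain ⟨V, _, G, hG, hV, hG'⟩ := hm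
  obtain ⟨W, _, H, hH, hW, hH'⟩ := hn
  obtain ⟨s, j, hs, hj⟩ := h (V ⊕ W) (G ⊕g H) (by
    rintro (v | w)
    · rw [degIn_sum_inl]
      convert hG v
      ext; simp
    · rw [degIn_sum_inr]
      convert hH w
      ext; simp) (by rw [Fintype.card_sum]; omega)
  rw [card_filter_degIn_sum] at hj
  have h1 := hG' s.toLeft j fun q v hv => by
    rw [← degIn_sum_inl G H]
    exact hs q _ (by simpa using hv)
  have h2 := hH' s.toRight j fun q v hv => by
    rw [← degIn_sum_inr G H]
    exact hs q _ (by simpa using hv)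
  omega

theorem superadditive_of_isLeast_forces {Q : Prop} {d : ℕ} {f : ℕ → ℕ}
    (hf : ∀ k, IsLeast {m | Forces Q k d m} (f k)) (k l : ℕ) : f k + f l ≤ f (k + l) := by
  have hkl : Forces Q (k + l) d (f (k + l)) := (hf (k + l)).1
  -- If `f k = 0`, there is no failing value `f k - 1` to combine, and monotonicity in `k` suffices.
  rcases Nat.eq_zero_or_pos (f k) with hk | hk
  · have := (hf l).2 (hkl.mono (Nat.le_add_left l k) le_rfl)
    omega
  rcases Nat.eq_zero_or_pos (f l) with hl | hl
  · have := (hf k).2 (hkl.mono (Nat.le_add_right k l) le_rfl)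
    omega
  have h1 : ¬ Forces Q k d (f k - 1) := fun h => by
    have := (hf k).2 h
    omega
  have h2 : ¬ Forces Q l d (f l - 1) := fun h => by
    have := (hf l).2 h
    omega
  by_contra! hlt
  exact not_forces_add h1 h2 (hkl.mono le_rfl (by omega))

/-- Fekete's lemma for `-f`. The last conclusion turns one value of `g` into a lower bound for the
limit. -/
theorem exists_tendsto_div_of_superadditive {f : ℕ → ℕ} (hf : ∀ k l, f k + f l ≤ f (k + l))
    {C : ℝ} (hC : ∀ k, (f k : ℝ) ≤ C * k) :
    ∃ L : ℝ, Tendsto (fun k : ℕ => (f k : ℝ) / k) atTop (𝓝 L) ∧ L ≤ C ∧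
      ∀ k : ℕ, k ≠ 0 → (f k : ℝ) / k ≤ L := by
  have hsub : Subadditive fun k => -(f k : ℝ) := fun k l => by
    have : (f k : ℝ) + f l ≤ f (k + l) := by exact_mod_cast hf k l
    linarith
  have hle : ∀ k : ℕ, (f k : ℝ) / k ≤ max C 0 := fun k => by
    rcases Nat.eq_zero_or_pos k with rfl | hk
    · simp
    · exact le_max_of_le_left ((div_le_iff₀ (by exact_mod_cast hk)).mpr (hC k))
  have hbdd : BddBelow (Set.range fun k : ℕ => -(f k : ℝ) / k) := by
    refine ⟨-max C 0, ?_⟩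
    rintro _ ⟨k, rfl⟩
    simp only [neg_div]
    exact neg_le_neg (hle k)
  have ht : Tendsto (fun k : ℕ => (f k : ℝ) / k) atTop (𝓝 (-hsub.lim)) := by
    have := (hsub.tendsto_lim hbdd).neg
    simpa [neg_div] using this
  refine ⟨-hsub.lim, ht, ?_, fun k hk => ?_⟩
  · refine le_of_tendsto ht ?_
    filter_upwards [eventually_gt_atTop 0] with k hk
    exact (div_le_iff₀ (by exact_mod_cast hk)).mpr (hC k)
  · have := hsub.lim_le_div hbdd hk
    rw [neg_div] at this
    linarith

end

/-! ### Comparison of `g` and `h`, and their limits -/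

theorem g_le_h (k d : ℕ) : g k d ≤ h k d := by
  classical
  refine (isLeast_g k d).2 fun V _ G hG hV => ?_
  obtain ⟨s, hs⟩ := (isLeast_h k d).1 V G hG hV
  exact ⟨s, hs.trans (maxrep_le_rep _)⟩

theorem h_le (k d : ℕ) : (h k d : ℝ) ≤ ((d : ℝ) / 2 + 1) * k := by
  have h1 : h k d ≤ (d + 2) * k / 2 := (isLeast_h k d).2 (forcesMaxrep_half k d)
  have h2 : 2 * h k d ≤ (d + 2) * k := by omega
  have h3 : (2 : ℝ) * h k d ≤ (d + 2) * k := by exact_mod_cast h2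
  linarith

theorem exists_tendsto_g_div (d : ℕ) :
    ∃ L : ℝ, Tendsto (fun k : ℕ => (g k d : ℝ) / k) atTop (𝓝 L) ∧
      ∀ k : ℕ, k ≠ 0 → (g k d : ℝ) / k ≤ L := by
  obtain ⟨L, h1, -, h2⟩ := exists_tendsto_div_of_superadditive
    (superadditive_of_isLeast_forces (Q := False) (d := d) (f := fun k => g k d) fun k => by
      simpa only [forcesRep_iff] using isLeast_g k d)
    fun k => (Nat.cast_le.mpr (g_le_h k d)).trans (h_le k d)
  exact ⟨L, h1, h2⟩

theorem exists_tendsto_h_div (d : ℕ) :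
    ∃ L : ℝ, Tendsto (fun k : ℕ => (h k d : ℝ) / k) atTop (𝓝 L) ∧ L ≤ (d : ℝ) / 2 + 1 := by
  obtain ⟨L, h1, h2, -⟩ := exists_tendsto_div_of_superadditive
    (superadditive_of_isLeast_forces (Q := True) (d := d) (f := fun k => h k d) fun k => by
      simpa only [forcesMaxrep_iff] using isLeast_h k d)
    fun k => h_le k d
  exact ⟨L, h1, h2⟩

/-! ### A random graph whose induced subgraphs have small repetition number -/

section

/-- An exponential moment bound for sums of independent weighted indicators. -/
theorem card_filter_sum_nonpos_le {ι : Type*} [Fintype ι] [DecidableEq ι] {N : ℕ} (hN : 0 < N)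
    (w : ι → ℕ) (hw : ∀ p, w p ≤ N) (c : ι → ℝ) (hc : ∀ p, |c p| ≤ 1) :
    ((Finset.univ.filter fun x : ι → Fin N =>
      ∑ p, (if (x p : ℕ) < w p then c p else 0) ≤ 0).card : ℝ) ≤
      (N : ℝ) ^ Fintype.card ι * Real.exp (∑ p, c p ^ 2 - (∑ p, c p * w p) / N) := by
  have hN' : (0 : ℝ) < N := by exact_mod_cast hN
  -- Use `exp (-c) ≤ 1 - c + c²` for `|c| ≤ 1`, average over the labels, then apply `1 + u ≤ exp u`.
  have hfac : ∀ p, ∑ i : Fin N, Real.exp (-(if (i : ℕ) < w p then c p else 0)) ≤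
      N * Real.exp (c p ^ 2 - c p * w p / N) := by
    intro p
    have h1 : ∀ i : Fin N, Real.exp (-(if (i : ℕ) < w p then c p else 0)) ≤
        1 + c p ^ 2 - if (i : ℕ) < w p then c p else 0 := by
      intro i
      split_ifs
      · have := (abs_le.mp (Real.abs_exp_sub_one_sub_id_le (x := -c p)
          (by rw [abs_neg]; exact hc p))).2
        rw [neg_sq] at this
        linarith
      · simp only [neg_zero, Real.exp_zero]
        nlinarith [sq_nonneg (c p)]
    have h2 : ∑ i : Fin N, (if (i : ℕ) < w p then c p else 0) = c p * w p := by
      rw [← Finset.sum_filter, Finset.sum_const, Fin.card_filter_val_lt, min_eq_right (hw p),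
        nsmul_eq_mul, mul_comm]
    calc _ ≤ ∑ i : Fin N, (1 + c p ^ 2 - if (i : ℕ) < w p then c p else 0) :=
          Finset.sum_le_sum fun i _ => h1 i
      _ = N * (c p ^ 2 - c p * w p / N + 1) := by
          rw [Finset.sum_sub_distrib, h2, Finset.sum_const, Finset.card_univ, Fintype.card_fin,
            nsmul_eq_mul]
          field_simp
          ring
      _ ≤ _ := mul_le_mul_of_nonneg_left (Real.add_one_le_exp _) hN'.le
  calc _ = ∑ x : ι → Fin N, if ∑ p, (if (x p : ℕ) < w p then c p else 0) ≤ 0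
          then (1 : ℝ) else 0 := by rw [Finset.sum_boole]
    _ ≤ ∑ x : ι → Fin N, ∏ p, Real.exp (-(if (x p : ℕ) < w p then c p else 0)) := by
        refine Finset.sum_le_sum fun x _ => ?_
        rw [← Real.exp_sum, Finset.sum_neg_distrib]
        split_ifs with h
        · exact Real.one_le_exp (by linarith)
        · exact (Real.exp_pos _).le
    _ = ∏ p, ∑ i : Fin N, Real.exp (-(if (i : ℕ) < w p then c p else 0)) := by
        rw [Finset.prod_univ_sum, Fintype.piFinset_univ]
    _ ≤ ∏ p : ι, (N * Real.exp (c p ^ 2 - c p * w p / N)) :=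
        Finset.prod_le_prod (fun p _ => Finset.sum_nonneg fun i _ => (Real.exp_pos _).le)
          fun p _ => hfac p
    _ = _ := by
        rw [Finset.prod_mul_distrib, Finset.prod_const, Finset.card_univ, ← Real.exp_sum,
          Finset.sum_sub_distrib, Finset.sum_div]

theorem two_mul_sum_lt {n : ℕ} (S : Finset (Fin n)) (F : Fin n → Fin n → ℝ)
    (hF : ∀ a b, F a b = F b a) :
    2 * ∑ a ∈ S, ∑ b ∈ S, (if a < b then F a b else 0) =
      ∑ a ∈ S, ∑ b ∈ S, F a b - ∑ a ∈ S, F a a := by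
  have h1 : ∑ a ∈ S, ∑ b ∈ S, F a b = ∑ a ∈ S, ∑ b ∈ S, (if a < b then F a b else 0) +
      ∑ a ∈ S, ∑ b ∈ S, (if b < a then F b a else 0) + ∑ a ∈ S, F a a := by
    rw [← Finset.sum_add_distrib, ← Finset.sum_add_distrib]
    refine Finset.sum_congr rfl fun a ha => ?_
    have : F a a = ∑ b ∈ S, if a = b then F a b else 0 := by
      rw [Finset.sum_ite_eq, if_pos ha]
    rw [this, ← Finset.sum_add_distrib, ← Finset.sum_add_distrib]
    refine Finset.sum_congr rfl fun b _ => ?_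
    rcases lt_trichotomy a b with h | h | h
    · simp [h, h.not_gt, h.ne]
    · simp [h]
    · simp [h, h.not_gt, h.ne', hF a b]
  have h2 : ∑ a ∈ S, ∑ b ∈ S, (if b < a then F b a else 0) =
      ∑ a ∈ S, ∑ b ∈ S, (if a < b then F a b else 0) := Finset.sum_comm
  rw [h1, h2]
  ring

/-- Disjoint sets of `t` elements of `S`, those of the second being larger by at least `t` than
those of the first. -/
def Separated {n : ℕ} (t : ℕ) (S T₁ T₂ : Finset (Fin n)) : Prop :=
  T₁ ⊆ S ∧ T₂ ⊆ S ∧ T₁.card = t ∧ T₂.card = t ∧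
    ∃ m : ℕ, (∀ a ∈ T₁, (a : ℕ) < m) ∧ ∀ a ∈ T₂, m + t ≤ (a : ℕ)

/-- Choose the least `m` with at least `t` elements of `U` below it; by minimality there are at most
`t`. The window `[m, m + t)` holds at most `t` more, so at least `t` elements lie beyond it. -/
theorem exists_separated {n : ℕ} {t : ℕ} (U : Finset (Fin n)) (hU : 3 * t ≤ U.card) :
    ∃ T₁ T₂, Separated t U T₁ T₂ := by
  have hex : ∃ m : ℕ, t ≤ (U.filter fun a : Fin n => (a : ℕ) < m).card :=
    ⟨n, by rw [Finset.filter_true_of_mem fun a _ => a.2]; omega⟩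
  obtain ⟨m, hm, hle⟩ : ∃ m : ℕ, t ≤ (U.filter fun a : Fin n => (a : ℕ) < m).card ∧
      (U.filter fun a : Fin n => (a : ℕ) < m).card ≤ t := by
    refine ⟨Nat.find hex, Nat.find_spec hex, ?_⟩
    rcases hk : Nat.find hex with _ | k
    · simp
    · have h1 := Nat.find_min hex (m := k) (by omega)
      have h2 : (U.filter fun a : Fin n => (a : ℕ) < k + 1) ⊆
          (U.filter fun a : Fin n => (a : ℕ) < k) ∪ Finset.univ.filter fun a : Fin n => (a : ℕ) = k := by
        intro a ha
        simp only [Finset.mem_union, Finset.mem_filter, Finset.mem_univ, true_and] at ha ⊢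
        rcases Nat.lt_succ_iff_lt_or_eq.mp ha.2 with h | h
        · exact Or.inl ⟨ha.1, h⟩
        · exact Or.inr h
      have h3 : (Finset.univ.filter fun a : Fin n => (a : ℕ) = k).card ≤ 1 :=
        Finset.card_le_one.mpr fun a ha b hb => by
          simp only [Finset.mem_filter, Finset.mem_univ, true_and] at ha hb
          exact Fin.ext (ha.trans hb.symm)
      have h4 := (Finset.card_le_card h2).trans (Finset.card_union_le _ _)
      omega
  have hsplit : U ⊆ (U.filter fun a : Fin n => (a : ℕ) < m) ∪
      (Finset.univ.filter fun a : Fin n => m ≤ (a : ℕ) ∧ (a : ℕ) < m + t) ∪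
        (U.filter fun a : Fin n => m + t ≤ (a : ℕ)) := by
    intro a ha
    simp only [Finset.mem_union, Finset.mem_filter, Finset.mem_univ, true_and, ha]
    omega
  have hmid : (Finset.univ.filter fun a : Fin n => m ≤ (a : ℕ) ∧ (a : ℕ) < m + t).card ≤ t := by
    calc _ = ((Finset.univ.filter fun a : Fin n => m ≤ (a : ℕ) ∧ (a : ℕ) < m + t).map
          Fin.valEmbedding).card := (Finset.card_map _).symm
      _ ≤ (Finset.Ico m (m + t)).card := Finset.card_le_card fun b hb => by
          simp only [Finset.mem_map, Finset.mem_filter, Finset.mem_univ, true_and] at hb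
          obtain ⟨a, ha, rfl⟩ := hb
          exact Finset.mem_Ico.mpr ha
      _ = t := by simp
  have h5 := (Finset.card_le_card hsplit).trans (Finset.card_union_le _ _)
  have h6 := Finset.card_union_le (U.filter fun a : Fin n => (a : ℕ) < m)
    (Finset.univ.filter fun a : Fin n => m ≤ (a : ℕ) ∧ (a : ℕ) < m + t)
  obtain ⟨T₁, hT₁, hc₁⟩ := Finset.exists_subset_card_eq hm
  obtain ⟨T₂, hT₂, hc₂⟩ := Finset.exists_subset_card_eq
    (show t ≤ (U.filter fun a : Fin n => m + t ≤ (a : ℕ)).card by omega)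
  exact ⟨T₁, T₂, hT₁.trans (Finset.filter_subset _ _), hT₂.trans (Finset.filter_subset _ _),
    hc₁, hc₂, m, fun a ha => (Finset.mem_filter.mp (hT₁ ha)).2,
    fun a ha => (Finset.mem_filter.mp (hT₂ ha)).2⟩

end

/-- The graph on `Fin n` in which `a < b` are adjacent if the label of `(a, b)` is less than
`a + b`. -/
def labelGraph {n : ℕ} (x : Fin n × Fin n → Fin (2 * n)) : SimpleGraph (Fin n) where
  Adj a b := (a < b ∧ (x (a, b) : ℕ) < a + b) ∨ (b < a ∧ (x (b, a) : ℕ) < b + a)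
  symm := ⟨fun _ _ h => h.symm⟩
  loopless := ⟨fun a h => by simp at h⟩

/-- `1` on `T₂` minus `1` on `T₁`. -/
def signOn {n : ℕ} (T₁ T₂ : Finset (Fin n)) (a : Fin n) : ℝ :=
  (if a ∈ T₂ then 1 else 0) - if a ∈ T₁ then 1 else 0

/-- The contribution of the edge `p` inside `S` to the degree sum over `T₂` minus the degree sum
over `T₁`. -/
def pairWeight {n : ℕ} (S T₁ T₂ : Finset (Fin n)) (p : Fin n × Fin n) : ℝ :=
  if p.1 ∈ S ∧ p.2 ∈ S ∧ p.1 < p.2 then signOn T₁ T₂ p.1 + signOn T₁ T₂ p.2 else 0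

section

variable {n : ℕ} {S T₁ T₂ : Finset (Fin n)}

theorem sum_signOn_mul (h₁ : T₁ ⊆ S) (h₂ : T₂ ⊆ S) (f : Fin n → ℝ) :
    ∑ a ∈ S, signOn T₁ T₂ a * f a = ∑ a ∈ T₂, f a - ∑ a ∈ T₁, f a := by
  simp only [signOn, sub_mul, ite_mul, one_mul, zero_mul, Finset.sum_sub_distrib,
    Finset.sum_ite_mem, Finset.inter_eq_right.mpr h₁, Finset.inter_eq_right.mpr h₂]

theorem abs_signOn_le (a : Fin n) : |signOn T₁ T₂ a| ≤ 1 := by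
  unfold signOn
  split_ifs <;> simp

theorem sum_pairWeight_mul (F : Fin n → Fin n → ℝ) :
    ∑ p, pairWeight S T₁ T₂ p * F p.1 p.2 =
      ∑ a ∈ S, ∑ b ∈ S,
        if a < b then (signOn T₁ T₂ a + signOn T₁ T₂ b) * F a b else 0 := by
  rw [Fintype.sum_prod_type, ← Finset.sum_subset (Finset.subset_univ S)]
  · refine Finset.sum_congr rfl fun a ha => ?_
    rw [← Finset.sum_subset (Finset.subset_univ S)]
    · refine Finset.sum_congr rfl fun b hb => ?_
      simp [pairWeight, ha, hb]
    · intro b _ hb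
      simp [pairWeight, hb]
  · intro a _ ha
    simp [pairWeight, ha]

theorem degIn_labelGraph (x : Fin n × Fin n → Fin (2 * n)) (S : Finset (Fin n)) (a : Fin n) :
    (degIn (labelGraph x) S a : ℝ) =
      ∑ b ∈ S, ((if a < b then if (x (a, b) : ℕ) < a + b then 1 else 0 else 0) +
        if b < a then if (x (b, a) : ℕ) < b + a then 1 else 0 else 0) := by
  classical
  unfold degIn
  rw [← Finset.sum_boole]
  refine Finset.sum_congr rfl fun b _ => ?_
  rcases lt_trichotomy a b with h | h | h
  · simp [labelGraph, h, h.not_gt]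
  · simp [labelGraph, h]
  · simp [labelGraph, h, h.not_gt]

theorem sum_degIn_sub_sum_degIn (h₁ : T₁ ⊆ S) (h₂ : T₂ ⊆ S)
    (x : Fin n × Fin n → Fin (2 * n)) :
    ∑ a ∈ T₂, (degIn (labelGraph x) S a : ℝ) - ∑ a ∈ T₁, (degIn (labelGraph x) S a : ℝ) =
      ∑ p : Fin n × Fin n, if (x p : ℕ) < p.1 + p.2 then pairWeight S T₁ T₂ p else 0 := by
  have hR : ∀ p : Fin n × Fin n, (if (x p : ℕ) < p.1 + p.2 then pairWeight S T₁ T₂ p else 0) =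
      pairWeight S T₁ T₂ p * if (x (p.1, p.2) : ℕ) < p.1 + p.2 then 1 else 0 := fun p => by simp
  rw [← sum_signOn_mul h₁ h₂, Finset.sum_congr rfl fun p _ => hR p,
    sum_pairWeight_mul fun a b => if (x (a, b) : ℕ) < a + b then 1 else 0]
  simp only [degIn_labelGraph, mul_add, Finset.sum_add_distrib, Finset.mul_sum]
  rw [add_comm, Finset.sum_comm, ← Finset.sum_add_distrib]
  refine Finset.sum_congr rfl fun a _ => ?_
  rw [← Finset.sum_add_distrib]
  refine Finset.sum_congr rfl fun b _ => ?_
  split_ifs <;> ring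

theorem Separated.sum_sub_sum_ge {t : ℕ} (hT : Separated t S T₁ T₂) :
    (t : ℝ) ^ 2 ≤ ∑ a ∈ T₂, ((a : ℕ) : ℝ) - ∑ a ∈ T₁, ((a : ℕ) : ℝ) := by
  obtain ⟨-, -, hc₁, hc₂, m, hm₁, hm₂⟩ := hT
  have h1 : ∑ a ∈ T₁, ((a : ℕ) : ℝ) ≤ T₁.card • (m : ℝ) :=
    Finset.sum_le_card_nsmul _ _ _ fun a ha => by exact_mod_cast (hm₁ a ha).le
  have h2 : T₂.card • ((m : ℝ) + t) ≤ ∑ a ∈ T₂, ((a : ℕ) : ℝ) :=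
    Finset.card_nsmul_le_sum _ _ _ fun a ha => by exact_mod_cast hm₂ a ha
  rw [hc₁, nsmul_eq_mul] at h1
  rw [hc₂, nsmul_eq_mul] at h2
  linarith

theorem Separated.two_mul_le_card {t : ℕ} (hT : Separated t S T₁ T₂) : 2 * t ≤ S.card := by
  obtain ⟨h₁, h₂, hc₁, hc₂, m, hm₁, hm₂⟩ := hT
  rw [two_mul]
  nth_rw 1 [← hc₁]
  rw [← hc₂, ← Finset.card_union_of_disjoint]
  · exact Finset.card_le_card (Finset.union_subset h₁ h₂)
  · rw [Finset.disjoint_left]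
    intro a ha hb
    have := hm₁ a ha
    have := hm₂ a hb
    omega

theorem Separated.sum_signOn {t : ℕ} (hT : Separated t S T₁ T₂) :
    ∑ a ∈ S, signOn T₁ T₂ a = 0 := by
  have := sum_signOn_mul hT.1 hT.2.1 fun _ => 1
  simpa [hT.2.2.1, hT.2.2.2.1] using this

/-- This is `2n` times the expected difference of the degree sums. With signs `e` of total `0` and
`E = ∑ e a * a ≥ t²`, the sum over all ordered pairs is `2 |S| E` and the diagonal is `4 E`; half
their difference is `(|S| - 2) E`. -/
theorem Separated.sum_pairWeight_mul_ge {t : ℕ} (hT : Separated t S T₁ T₂) (ht : 1 ≤ t) :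
    ((S.card : ℝ) - 2) * t ^ 2 ≤
      ∑ p : Fin n × Fin n, pairWeight S T₁ T₂ p * ((p.1 + p.2 : ℕ) : ℝ) := by
  have hS : (2 : ℝ) ≤ S.card := by
    have := hT.two_mul_le_card
    exact_mod_cast (show 2 ≤ S.card by omega)
  set e := signOn T₁ T₂ with he
  have h0 : ∑ a ∈ S, e a = 0 := hT.sum_signOn
  have hE := hT.sum_sub_sum_ge
  rw [← sum_signOn_mul hT.1 hT.2.1, ← he] at hE
  set E := ∑ a ∈ S, e a * ((a : ℕ) : ℝ)
  have h1 := two_mul_sum_lt S (fun a b => (e a + e b) * ((a + b : ℕ) : ℝ))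
    fun a b => by rw [add_comm (e a), add_comm (a : ℕ)]
  have h2 : ∑ a ∈ S, ∑ b ∈ S, (e a + e b) * ((a + b : ℕ) : ℝ) = 2 * S.card * E := by
    have : ∀ a ∈ S, ∑ b ∈ S, (e a + e b) * ((a + b : ℕ) : ℝ) =
        S.card * (e a * ((a : ℕ) : ℝ)) + e a * ∑ b ∈ S, ((b : ℕ) : ℝ) + E := fun a _ => by
      have h3 : ∀ b ∈ S, (e a + e b) * ((a + b : ℕ) : ℝ) = e a * ((a : ℕ) : ℝ) +
          e a * ((b : ℕ) : ℝ) + e b * ((a : ℕ) : ℝ) + e b * ((b : ℕ) : ℝ) := fun b _ => by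
        push_cast; ring
      rw [Finset.sum_congr rfl h3]
      simp only [Finset.sum_add_distrib, ← Finset.mul_sum, ← Finset.sum_mul, h0, Finset.sum_const,
        nsmul_eq_mul]
      ring
    rw [Finset.sum_congr rfl this]
    simp only [Finset.sum_add_distrib, ← Finset.mul_sum, ← Finset.sum_mul, h0, Finset.sum_const,
      nsmul_eq_mul]
    ring
  have h3 : ∑ a ∈ S, (e a + e a) * ((a + a : ℕ) : ℝ) = 4 * E := by
    rw [Finset.mul_sum]
    exact Finset.sum_congr rfl fun a _ => by push_cast; ring
  rw [sum_pairWeight_mul fun a b => ((a + b : ℕ) : ℝ)]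
  rw [h2, h3] at h1
  nlinarith

/-- Extend the sum to all ordered pairs in `S`: the cross terms cancel because the signs sum to `0`,
and the squares contribute `2 |S|` times at most `2 t`. -/
theorem Separated.sum_pairWeight_sq_le {t : ℕ} (hT : Separated t S T₁ T₂) :
    ∑ p, pairWeight S T₁ T₂ p ^ 2 ≤ 4 * S.card * t := by
  have h0 : ∑ a ∈ S, signOn T₁ T₂ a = 0 := hT.sum_signOn
  have hsq : ∑ a ∈ S, signOn T₁ T₂ a ^ 2 ≤ 2 * t := by
    calc _ ≤ ∑ a ∈ S, ((if a ∈ T₂ then (1 : ℝ) else 0) + if a ∈ T₁ then 1 else 0) := by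
          refine Finset.sum_le_sum fun a _ => ?_
          unfold signOn
          split_ifs <;> norm_num
      _ = 2 * t := by
          rw [Finset.sum_add_distrib, Finset.sum_ite_mem, Finset.sum_ite_mem,
            Finset.inter_eq_right.mpr hT.1, Finset.inter_eq_right.mpr hT.2.1]
          simp [hT.2.2.1, hT.2.2.2.1, two_mul]
  have hE : ∑ p, pairWeight S T₁ T₂ p ^ 2 =
      ∑ p, pairWeight S T₁ T₂ p * (fun a b => signOn T₁ T₂ a + signOn T₁ T₂ b) p.1 p.2 := by
    refine Finset.sum_congr rfl fun p _ => ?_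
    unfold pairWeight
    split_ifs <;> ring
  rw [hE, sum_pairWeight_mul fun a b => signOn T₁ T₂ a + signOn T₁ T₂ b]
  calc _ ≤ ∑ a ∈ S, ∑ b ∈ S, (signOn T₁ T₂ a + signOn T₁ T₂ b) ^ 2 := by
        refine Finset.sum_le_sum fun a _ => Finset.sum_le_sum fun b _ => ?_
        split_ifs
        · rw [sq]
        · exact sq_nonneg _
    _ = 2 * S.card * ∑ a ∈ S, signOn T₁ T₂ a ^ 2 := by
        simp only [add_sq, Finset.sum_add_distrib, ← Finset.mul_sum, ← Finset.sum_mul, h0,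
          Finset.sum_const, nsmul_eq_mul]
        ring
    _ ≤ 4 * S.card * t := by
        have : (0 : ℝ) ≤ S.card := by positivity
        nlinarith

theorem Separated.card_filter_sum_degIn_le {t : ℕ} (hT : Separated t S T₁ T₂) (ht : 2 ≤ t) :
    ((Finset.univ.filter fun x : Fin n × Fin n → Fin (2 * n) =>
      ∑ a ∈ T₂, degIn (labelGraph x) S a ≤ ∑ a ∈ T₁, degIn (labelGraph x) S a).card : ℝ) ≤
      ((2 * n : ℕ) : ℝ) ^ (n * n) * Real.exp (-(t : ℝ) ^ 3 / (256 * n ^ 2)) ^ S.card := by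
  have hSt := hT.two_mul_le_card
  have hSn : S.card ≤ n := by simpa using S.card_le_univ
  have hn : (0 : ℝ) < n := by exact_mod_cast (show 0 < n by omega)
  have htn : (t : ℝ) ≤ n := by exact_mod_cast (show t ≤ n by omega)
  have ht0 : (0 : ℝ) < t := by exact_mod_cast (show 0 < t by omega)
  have hS4 : (4 : ℝ) ≤ S.card := by exact_mod_cast (show 4 ≤ S.card by omega)
  -- This minimises the exponent `4 |S| t θ² - θ |S| t² / (4n)`, with minimum `-|S| t³ / (256 n²)`.
  -- The linear term uses `|S| - 2 ≥ |S| / 2`, valid since `|S| ≥ 4`.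
  set θ : ℝ := t / (32 * n) with hθ
  have hθ0 : 0 < θ := by positivity
  have hθ1 : θ ≤ 1 / 32 := by
    rw [hθ, div_le_iff₀ (by positivity)]
    linarith
  have key := card_filter_sum_nonpos_le (N := 2 * n) (by omega)
    (fun p : Fin n × Fin n => (p.1 + p.2 : ℕ)) (fun p => by omega)
    (fun p => θ * pairWeight S T₁ T₂ p) fun p => by
      have : |pairWeight S T₁ T₂ p| ≤ 2 := by
        unfold pairWeight
        split_ifs
        · have h1 := abs_signOn_le (T₁ := T₁) (T₂ := T₂) p.1
          have h2 := abs_signOn_le (T₁ := T₁) (T₂ := T₂) p.2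
          exact (abs_add_le _ _).trans (by linarith)
        · simp
      rw [abs_mul, abs_of_pos hθ0]
      nlinarith [abs_nonneg (pairWeight S T₁ T₂ p)]
  refine le_trans (le_of_eq ?_) (key.trans ?_)
  · congr 2
    ext x
    simp only [Finset.mem_filter, Finset.mem_univ, true_and]
    have h1 : ∑ p : Fin n × Fin n, (if (x p : ℕ) < p.1 + p.2 then θ * pairWeight S T₁ T₂ p else 0)
        = θ * (∑ a ∈ T₂, (degIn (labelGraph x) S a : ℝ) -
          ∑ a ∈ T₁, (degIn (labelGraph x) S a : ℝ)) := by
      rw [sum_degIn_sub_sum_degIn hT.1 hT.2.1, Finset.mul_sum]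
      exact Finset.sum_congr rfl fun p _ => by rw [mul_ite, mul_zero]
    rw [h1, ← mul_zero θ, mul_le_mul_iff_right₀ hθ0, sub_nonpos]
    exact_mod_cast Iff.rfl
  · rw [Fintype.card_prod, Fintype.card_fin, ← Real.exp_nat_mul]
    refine mul_le_mul_of_nonneg_left (Real.exp_le_exp.mpr ?_) (by positivity)
    simp only [mul_pow, mul_assoc]
    rw [← Finset.mul_sum, ← Finset.mul_sum]
    have h1 := mul_le_mul_of_nonneg_left hT.sum_pairWeight_sq_le (sq_nonneg θ)
    have h2 := mul_le_mul_of_nonneg_left (hT.sum_pairWeight_mul_ge (by omega)) hθ0.le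
    have h3 : (S.card : ℝ) / 2 * t ^ 2 ≤ (S.card - 2) * t ^ 2 :=
      mul_le_mul_of_nonneg_right (by linarith) (by positivity)
    have h4 := mul_le_mul_of_nonneg_left h3 hθ0.le
    have h5 := div_le_div_of_nonneg_right (h4.trans h2) (show (0 : ℝ) ≤ ((2 * n : ℕ) : ℝ) by positivity)
    refine (sub_le_sub h1 h5).trans (le_of_eq ?_)
    rw [hθ]
    push_cast
    field_simp
    ring

/-- There are labels for which no separated pair is balanced. -/
theorem exists_forall_separated {t : ℕ} (hn : 0 < n) (ht : 2 ≤ t)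
    (htn : 8 * (n : ℝ) * Real.exp (-(t : ℝ) ^ 3 / (256 * n ^ 2)) ≤ 1) :
    ∃ x : Fin n × Fin n → Fin (2 * n), ∀ S T₁ T₂ : Finset (Fin n), Separated t S T₁ T₂ →
      ∑ a ∈ T₁, degIn (labelGraph x) S a < ∑ a ∈ T₂, degIn (labelGraph x) S a := by
  classical
  by_contra! hcon
  have hn0 : (0 : ℝ) < n := by exact_mod_cast hn
  set q := Real.exp (-(t : ℝ) ^ 3 / (256 * n ^ 2)) with hq
  have hq0 : 0 < q := Real.exp_pos _
  set M : ℝ := ((2 * n : ℕ) : ℝ) ^ (n * n) with hM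
  have hM0 : 0 < M := by
    rw [hM]
    push_cast
    positivity
  let bad : Finset (Fin n) → Finset (Fin n) → Finset (Fin n) →
      Finset (Fin n × Fin n → Fin (2 * n)) := fun S T₁ T₂ =>
    Finset.univ.filter fun x => Separated t S T₁ T₂ ∧
      ∑ a ∈ T₂, degIn (labelGraph x) S a ≤ ∑ a ∈ T₁, degIn (labelGraph x) S a
  have hbad : ∀ S T₁ T₂, ((bad S T₁ T₂).card : ℝ) ≤ if S.Nonempty then M * q ^ S.card else 0 := by
    intro S T₁ T₂
    by_cases hT : Separated t S T₁ T₂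
    · have hS : S.Nonempty := Finset.card_pos.mp (by have := hT.two_mul_le_card; omega)
      rw [if_pos hS]
      simpa only [bad, hT, true_and] using hT.card_filter_sum_degIn_le ht
    · simp only [bad, hT, false_and, Finset.filter_false, Finset.card_empty, Nat.cast_zero]
      split_ifs
      · positivity
      · exact le_rfl
  have hcover : (Finset.univ : Finset (Fin n × Fin n → Fin (2 * n))) ⊆
      Finset.univ.biUnion fun S : Finset (Fin n) => S.powerset.biUnion fun T₁ => S.powerset.biUnion fun T₂ =>
        bad S T₁ T₂ := by
    intro x _
    obtain ⟨S, T₁, T₂, hT, hx⟩ := hcon x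
    simp only [Finset.mem_biUnion, Finset.mem_powerset]
    exact ⟨S, Finset.mem_univ _, T₁, hT.1, T₂, hT.2.1,
      Finset.mem_filter.mpr ⟨Finset.mem_univ _, hT, hx⟩⟩
  have hcard : M ≤ ∑ S : Finset (Fin n), ∑ T₁ ∈ S.powerset, ∑ T₂ ∈ S.powerset,
      ((bad S T₁ T₂).card : ℝ) := by
    have h1 : Fintype.card (Fin n × Fin n → Fin (2 * n)) ≤
        ∑ S : Finset (Fin n), ∑ T₁ ∈ S.powerset, ∑ T₂ ∈ S.powerset, (bad S T₁ T₂).card :=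
      (Finset.card_le_card hcover).trans <| Finset.card_biUnion_le.trans <|
        Finset.sum_le_sum fun S _ => Finset.card_biUnion_le.trans <|
          Finset.sum_le_sum fun T₁ _ => Finset.card_biUnion_le
    rw [Fintype.card_fun, Fintype.card_prod, Fintype.card_fin, Fintype.card_fin] at h1
    rw [hM]
    exact_mod_cast h1
  -- Union bound: each nonempty `S` contributes at most `M * (4 q) ^ |S|`, and the binomial theorem
  -- sums these. The empty set is subtracted since it carries no separated pair.
  have hsum : ∑ S : Finset (Fin n), ∑ T₁ ∈ S.powerset, ∑ T₂ ∈ S.powerset,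
      ((bad S T₁ T₂).card : ℝ) ≤ M * ((4 * q + 1) ^ n - 1) := by
    calc _ ≤ ∑ S : Finset (Fin n), M * ((4 * q) ^ S.card - if S = ∅ then 1 else 0) := by
          refine Finset.sum_le_sum fun S _ => ?_
          refine (Finset.sum_le_sum fun T₁ _ => Finset.sum_le_sum fun T₂ _ =>
            hbad S T₁ T₂).trans (le_of_eq ?_)
          rcases S.eq_empty_or_nonempty with rfl | hS
          · simp
          · simp only [if_pos hS, if_neg hS.ne_empty, Finset.sum_const, Finset.card_powerset,
              nsmul_eq_mul, mul_pow, show (4 : ℝ) = 2 * 2 by norm_num]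
            push_cast
            ring
      _ = M * ((4 * q + 1) ^ n - 1) := by
          rw [← Finset.mul_sum, Finset.sum_sub_distrib, ← Fin.sum_pow_mul_eq_add_pow]
          simp
  have hexp : (4 * q + 1) ^ n < 2 := by
    calc (4 * q + 1) ^ n ≤ Real.exp (4 * q) ^ n :=
          pow_le_pow_left₀ (by positivity) (Real.add_one_le_exp _) _
      _ = Real.exp (n * (4 * q)) := (Real.exp_nat_mul _ _).symm
      _ ≤ Real.exp (1 / 2) := Real.exp_le_exp.mpr (by linarith)
      _ < 2 := by
          have h1 : Real.exp (1 / 2) ^ 2 = Real.exp 1 := by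
            rw [← Real.exp_nat_mul]
            norm_num
          have h2 := Real.exp_one_lt_d9
          nlinarith [Real.exp_pos (1 / 2)]
  nlinarith [hcard.trans hsum]

end

/-! ### Choice of parameters for the lower bound -/

theorem lt_g_of_exp_le {d t : ℕ} (ht : 2 ≤ t)
    (htn : 8 * ((d : ℝ) + 1) * Real.exp (-(t : ℝ) ^ 3 / (256 * ((d : ℝ) + 1) ^ 2)) ≤ 1) :
    d < g (3 * t) d := by
  obtain ⟨x, hx⟩ := exists_forall_separated (n := d + 1) (t := t) d.succ_pos ht
    (by push_cast; exact htn)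
  by_contra! hle
  have hF := ((forcesRep_iff (3 * t) d _).mp (isLeast_g (3 * t) d).1).mono le_rfl hle
  obtain ⟨S, j, -, hj⟩ := hF (Fin (d + 1)) (labelGraph x) (fun v => by
    classical
    rw [degIn_univ]
    have := (labelGraph x).degree_lt_card_verts v
    rw [Fintype.card_fin] at this
    omega) (by simp)
  obtain ⟨T₁, T₂, hT⟩ := exists_separated _ hj
  have hc₁ : ∀ a ∈ T₁, degIn (labelGraph x) S a = j := fun a ha =>
    (Finset.mem_filter.mp (hT.1 ha)).2
  have hc₂ : ∀ a ∈ T₂, degIn (labelGraph x) S a = j := fun a ha =>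
    (Finset.mem_filter.mp (hT.2.1 ha)).2
  have h := hx S T₁ T₂ ⟨hT.1.trans (Finset.filter_subset _ _),
    hT.2.1.trans (Finset.filter_subset _ _), hT.2.2⟩
  rw [Finset.sum_congr rfl hc₁, Finset.sum_congr rfl hc₂, Finset.sum_const, Finset.sum_const,
    hT.2.2.1, hT.2.2.2.1] at h
  exact lt_irrefl _ h

theorem exists_lt_g_and_rpow_mul_le {d : ℕ} (hd : 2 ≤ d) :
    ∃ t : ℕ, t ≠ 0 ∧ d < g (3 * t) d ∧
      ((d : ℝ) / Real.log d) ^ ((1 : ℝ) / 3) * t ≤ 22 * (d + 1) := by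
  have hd' : (2 : ℝ) ≤ d := by exact_mod_cast hd
  have hlogd : 0 < Real.log d := Real.log_pos (by linarith)
  set n : ℝ := d + 1 with hn
  have hn3 : 3 ≤ n := by linarith
  have hlog1 : 1 ≤ Real.log (8 * n) := by
    rw [Real.le_log_iff_exp_le (by linarith)]
    have := Real.exp_one_lt_d9
    linarith
  have hlog5 : Real.log (8 * n) ≤ 5 * Real.log d := by
    rw [show (5 : ℝ) * Real.log d = ((5 : ℕ) : ℝ) * Real.log d by norm_num, ← Real.log_pow]
    refine Real.log_le_log (by linarith) ?_
    have h4 : (2 : ℝ) ^ 4 ≤ (d : ℝ) ^ 4 := pow_le_pow_left₀ (by norm_num) hd' 4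
    nlinarith
  set y : ℝ := ((d : ℝ) / Real.log d) ^ ((1 : ℝ) / 3) with hy
  -- `t ^ 3 ≥ A` is exactly what makes `8 n exp (-t³ / (256 n²)) ≤ 1`; hence `t` is the ceiling of
  -- the cube root of `A`.
  set A : ℝ := 256 * n ^ 2 * Real.log (8 * n) with hA
  set z : ℝ := A ^ ((1 : ℝ) / 3) with hz
  have hcube : ∀ u : ℝ, 0 ≤ u → (u ^ ((1 : ℝ) / 3)) ^ 3 = u := fun u hu => by
    rw [← Real.rpow_natCast, ← Real.rpow_mul hu]
    norm_num
  have hA8 : 8 ≤ A := by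
    rw [hA]
    nlinarith
  have hz3 : z ^ 3 = A := hcube A (by linarith)
  have hz0 : 0 ≤ z := Real.rpow_nonneg (by linarith) _
  have hy3 : y ^ 3 = d / Real.log d := hcube _ (by positivity)
  have hy0 : 0 ≤ y := Real.rpow_nonneg (by positivity) _
  have hz2 : 2 ≤ z := by
    refine le_of_pow_le_pow_left₀ (n := 3) (by norm_num) hz0 ?_
    rw [hz3]
    linarith
  have hzt : z ≤ ⌈z⌉₊ := Nat.le_ceil z
  have ht2 : 2 ≤ ⌈z⌉₊ := by exact_mod_cast hz2.trans hzt
  refine ⟨⌈z⌉₊, by omega, lt_g_of_exp_le ht2 ?_, ?_⟩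
  · rw [← hn]
    have h1 : Real.log (8 * n) ≤ (⌈z⌉₊ : ℝ) ^ 3 / (256 * n ^ 2) := by
      rw [le_div_iff₀ (by positivity), mul_comm, ← hA, ← hz3]
      exact pow_le_pow_left₀ hz0 hzt 3
    calc 8 * n * Real.exp (-(⌈z⌉₊ : ℝ) ^ 3 / (256 * n ^ 2))
        ≤ 8 * n * Real.exp (-Real.log (8 * n)) := by
          refine mul_le_mul_of_nonneg_left (Real.exp_le_exp.mpr ?_) (by linarith)
          rw [neg_div]
          exact neg_le_neg h1
      _ = 1 := by
          rw [Real.exp_neg, Real.exp_log (by linarith)]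
          exact mul_inv_cancel₀ (by positivity)
  -- Cubing reduces this to `1280 = 256 * 5 ≤ 11 ^ 3`; rounding up at most doubles `z`, giving `22`.
  · have h1 : y * z ≤ 11 * n := by
      refine le_of_pow_le_pow_left₀ (n := 3) (by norm_num) (by positivity) ?_
      rw [mul_pow, hy3, hz3, hA]
      calc (d : ℝ) / Real.log d * (256 * n ^ 2 * Real.log (8 * n))
          ≤ d / Real.log d * (256 * n ^ 2 * (5 * Real.log d)) := by gcongr
        _ = 1280 * d * n ^ 2 := by
            field_simp
            ring
        _ ≤ (11 * n) ^ 3 := by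
            have : (d : ℝ) ≤ n := by linarith
            nlinarith [sq_nonneg n]
    have h2 : (⌈z⌉₊ : ℝ) ≤ 2 * z := by
      have := Nat.ceil_lt_add_one hz0
      linarith
    nlinarith

end InducedRep

theorem theorem2 :
    ∃ c : ℝ, 0 < c ∧ ∀ d : ℕ, 2 ≤ d →
      ∃ Lg Lh : ℝ,
        Tendsto (fun k : ℕ => (InducedRep.g k d : ℝ) / (k : ℝ)) atTop (𝓝 Lg) ∧
        Tendsto (fun k : ℕ => (InducedRep.h k d : ℝ) / (k : ℝ)) atTop (𝓝 Lh) ∧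
        c * ((d : ℝ) / Real.log (d : ℝ)) ^ ((1 : ℝ) / 3) ≤ Lg ∧
        Lg ≤ Lh ∧
        Lh ≤ (d : ℝ) / 2 + 1 := by
  -- `66 = 3 * 22`: the limit is at least `(d + 1) / (3 t)`, and `22 (d + 1)` bounds the cube root
  -- times `t`.
  refine ⟨1 / 66, by norm_num, fun d hd => ?_⟩
  obtain ⟨Lg, hg, hgL⟩ := InducedRep.exists_tendsto_g_div d
  obtain ⟨Lh, hh, hhL⟩ := InducedRep.exists_tendsto_h_div d
  refine ⟨Lg, Lh, hg, hh, ?_, ?_, hhL⟩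
  · obtain ⟨t, ht, hlt, hle⟩ := InducedRep.exists_lt_g_and_rpow_mul_le hd
    refine le_trans ?_ (hgL (3 * t) (by omega))
    have ht0 : (0 : ℝ) < t := by exact_mod_cast Nat.pos_of_ne_zero ht
    have hlt' : (d : ℝ) + 1 ≤ InducedRep.g (3 * t) d := by exact_mod_cast hlt
    rw [Nat.cast_mul, le_div_iff₀ (by positivity)]
    push_cast
    linarith
  · exact le_of_tendsto_of_tendsto' hg hh fun k =>
      div_le_div_of_nonneg_right (Nat.cast_le.mpr (InducedRep.g_le_h k d)) (Nat.cast_nonneg k)
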